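/- Let $(\mathcal K,[\cdot,\cdot])$ be a Krein space and let $N$ be a bounded linear normal operator on $\mathcal K$, i.e. $NN^*=N^*N$, where $N^*$ is the Krein space adjoint. Put $A=\frac{N+N^*}{2}$ and $B=\frac{N-N^*}{2i}$, and assume that $N$ is definitizable: there are nonzero real polynomials $p,q\in\mathbb R[z]$ with $[p(A)x,x]\ge 0$ and $[q(B)x,x]\ge 0$ for all $x\in\mathcal K$. Fix such $p$ and $q$. Let $$Z_p^{\mathbb R}=p^{-1}\{0\}\cap\mathbb R,\qquad Z_q^{\mathbb R}=q^{-1}\{0\}\cap\mathbb R,\qquad Z^i=(p^{-1}\{0\}\times q^{-1}\{0\})\setminus(\mathbb R\times\mathbb R),$$ where $p^{-1}\{0\}$ and $q^{-1}\{0\}$ denote the sets of complex zeros. There exist a Hilbert space $\mathcal V$ and an injective bounded linear operator $T:\mathcal V\to\mathcal K$ with $TT^*=p(A)+q(B)$, where $T^*:\mathcal K\to\mathcal V$ is the adjoint with respect to $[\cdot,\cdot]$ and the inner product of $\mathcal V$. For every such pair $(\mathcal V,T)$ let $\Theta(N)=T^{-1}NT$, i.e. $\Theta(N)$ is the bounded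 linear operator on $\mathcal V$ with $T\,\Theta(N)=NT$. Then $$\sigma(N)=\sigma(\Theta(N))\ \cup\ \big((Z_p^{\mathbb R}+iZ_q^{\mathbb R})\cap\sigma(N)\big)\ \cup\ \{\alpha+i\beta:\ (\alpha,\beta)\in Z^i,\ \alpha+i\beta\in\sigma(N),\ \bar\alpha+i\bar\beta\in\sigma(N)\}.$$ -/

import Mathlib

universe u v

open Polynomial
open scoped ComplexOrder InnerProductSpace

/-- A Krein space, presented by a Hilbert space `K` together with a fundamental symmetry `J`
(`J` is self-adjoint and `J ^ 2 = 1`).  The Krein space inner product is `[x, y] = ⟨J x, y⟩`,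
see `kreinForm`; the decomposition of `K` into the eigenspaces of `J` for `1` and `-1` is a
fundamental decomposition, and the Hilbert space topology is the Krein space topology. -/
class KreinSpace (K : Type*) [NormedAddCommGroup K] [InnerProductSpace ℂ K]
    [CompleteSpace K] where
  J : K →L[ℂ] K
  isSelfAdjoint_J : IsSelfAdjoint J
  J_mul_J : J * J = 1

section Krein

variable {K : Type*} [NormedAddCommGroup K] [InnerProductSpace ℂ K] [CompleteSpace K]
  [KreinSpace K]
variable {V : Type*} [NormedAddCommGroup V] [InnerProductSpace ℂ V] [CompleteSpace V]

/-- The Krein space inner product `[x, y]`, linear in `x` and conjugate linear in `y`. -/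
noncomputable def kreinForm (x y : K) : ℂ := ⟪y, KreinSpace.J x⟫_ℂ

/-- The Krein space adjoint `N ^ *` of a bounded operator `N` on `K`:
`[N x, y] = [x, N ^ * y]`, see `kreinForm_apply_left`. -/
noncomputable def kreinAdjoint (N : K →L[ℂ] K) : K →L[ℂ] K :=
  KreinSpace.J * ContinuousLinearMap.adjoint N * KreinSpace.J

/-- The adjoint `T ^ *` of a bounded operator `T` from a Hilbert space `V` to the Krein space
`K`: `[T v, x] = ⟨v, T ^ * x⟩`, see `kreinForm_hilbert_left`. -/
noncomputable def hilbertKreinAdjoint (T : V →L[ℂ] K) : K →L[ℂ] V :=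
  ContinuousLinearMap.adjoint T ∘L KreinSpace.J

/-- `N` is normal: it commutes with its Krein space adjoint. -/
def IsKreinNormal (N : K →L[ℂ] K) : Prop := Commute N (kreinAdjoint N)

/-- The real part `A = (N + N ^ *) / 2`. -/
noncomputable def kreinRe (N : K →L[ℂ] K) : K →L[ℂ] K :=
  (1 / 2 : ℂ) • (N + kreinAdjoint N)

/-- The imaginary part `B = (N - N ^ *) / (2 i)`. -/
noncomputable def kreinIm (N : K →L[ℂ] K) : K →L[ℂ] K :=
  (1 / (2 * Complex.I) : ℂ) • (N - kreinAdjoint N)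

/-- The real polynomial `p` is definitizing for `A`: `p ≠ 0` and `[p(A) x, x] ≥ 0` for all `x`. -/
def IsDefinitizing (p : ℝ[X]) (A : K →L[ℂ] K) : Prop :=
  p ≠ 0 ∧ ∀ x : K, 0 ≤ kreinForm (aeval A p x) x

/-- The operator `T T ^ *` on `K`. -/
noncomputable def gramOperator (T : V →L[ℂ] K) : K →L[ℂ] K :=
  T ∘L hilbertKreinAdjoint T

theorem KreinSpace.J_J (x : K) : (KreinSpace.J (KreinSpace.J x) : K) = x := by
  have := congrArg (fun f : K →L[ℂ] K => f x) (KreinSpace.J_mul_J (K := K))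
  simpa using this

theorem KreinSpace.inner_J_left (x y : K) :
    ⟪(KreinSpace.J x : K), y⟫_ℂ = ⟪x, KreinSpace.J y⟫_ℂ := by
  have h := (ContinuousLinearMap.isSelfAdjoint_iff'.mp (KreinSpace.isSelfAdjoint_J (K := K)))
  conv_rhs => rw [← h]
  rw [ContinuousLinearMap.adjoint_inner_right]

theorem kreinForm_apply_left (N : K →L[ℂ] K) (x y : K) :
    kreinForm (N x) y = kreinForm x (kreinAdjoint N y) := by
  simp only [kreinForm, kreinAdjoint, mul_apply_eq_comp]
  rw [KreinSpace.inner_J_left, KreinSpace.J_J, ContinuousLinearMap.adjoint_inner_left,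
    KreinSpace.inner_J_left]

theorem kreinForm_hilbert_left (T : V →L[ℂ] K) (v : V) (x : K) :
    kreinForm (T v) x = ⟪hilbertKreinAdjoint T x, v⟫_ℂ := by
  simp only [kreinForm, hilbertKreinAdjoint, ContinuousLinearMap.comp_apply]
  rw [ContinuousLinearMap.adjoint_inner_left, KreinSpace.inner_J_left]

theorem kreinForm_ext {x y : K} (h : ∀ z, kreinForm x z = kreinForm y z) : x = y := by
  have h1 : (KreinSpace.J x : K) = KreinSpace.J y :=
    ext_inner_left ℂ (fun z => h z)
  rw [← KreinSpace.J_J x, h1, KreinSpace.J_J]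

theorem kreinForm_gram (T : V →L[ℂ] K) (x y : K) :
    kreinForm (gramOperator T x) y
      = ⟪hilbertKreinAdjoint T y, hilbertKreinAdjoint T x⟫_ℂ :=
  kreinForm_hilbert_left T _ y

theorem denseRange_hilbertKreinAdjoint (T : V →L[ℂ] K) (hT : Function.Injective T) :
    DenseRange (hilbertKreinAdjoint T) := by
  have h : (LinearMap.range (hilbertKreinAdjoint T).toLinearMap).topologicalClosure = ⊤ := by
    rw [Submodule.topologicalClosure_eq_top_iff, Submodule.eq_bot_iff]
    intro v hv
    apply hT
    rw [map_zero]
    apply kreinForm_ext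
    intro z
    have h0 : ⟪hilbertKreinAdjoint T z, v⟫_ℂ = 0 :=
      (Submodule.mem_orthogonal _ v).mp hv _ ⟨z, rfl⟩
    rw [kreinForm_hilbert_left, h0]
    simp [kreinForm]
  exact (Submodule.dense_iff_topologicalClosure_eq_top).mpr h

/-- A bounded operator `D` that is symmetric with respect to `⟨T ^ * x, T ^ * y⟩` is bounded
with respect to the corresponding seminorm. -/
theorem norm_hilbertKreinAdjoint_le (T : V →L[ℂ] K) (D : K →L[ℂ] K)
    (hD : ∀ x y, ⟪hilbertKreinAdjoint T (D x), hilbertKreinAdjoint T y⟫_ℂ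
      = ⟪hilbertKreinAdjoint T x, hilbertKreinAdjoint T (D y)⟫_ℂ) (x : K) :
    ‖hilbertKreinAdjoint T (D x)‖ ≤ ‖D‖ * ‖hilbertKreinAdjoint T x‖ := by
  set S := hilbertKreinAdjoint T
  have hDn : ∀ (n : ℕ) (x y : K), ⟪S ((D ^ n) x), S y⟫_ℂ = ⟪S x, S ((D ^ n) y)⟫_ℂ := by
    intro n
    induction n with
    | zero => intro x y; simp
    | succ n ih =>
      intro x y
      rw [pow_succ, mul_apply_eq_comp, ih, hD, ← mul_apply_eq_comp,
        ← pow_succ', ← pow_succ]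
  have hstep : ∀ n : ℕ, ‖S ((D ^ n) x)‖ ^ 2 ≤ ‖S x‖ * ‖S ((D ^ (2 * n)) x)‖ := by
    intro n
    have h1 : ((‖S ((D ^ n) x)‖ ^ 2 : ℝ) : ℂ) = ⟪S x, S ((D ^ (2 * n)) x)⟫_ℂ := by
      rw [two_mul, pow_add, mul_apply_eq_comp, ← hDn, inner_self_eq_norm_sq_to_K]
      simp
    have h2 := norm_inner_le_norm (𝕜 := ℂ) (S x) (S ((D ^ (2 * n)) x))
    rw [← h1, Complex.norm_real, Real.norm_of_nonneg (by positivity)] at h2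
    exact h2
  rcases (norm_nonneg (S x)).eq_or_lt with h0 | h0
  · have h := hstep 1
    rw [← h0, zero_mul, pow_one] at h
    have h3 : ‖S (D x)‖ = 0 := by nlinarith [norm_nonneg (S (D x))]
    rw [h3, ← h0, mul_zero]
  · by_contra! hlt
    have hgrow : ∀ n : ℕ, ‖S x‖ * (‖S (D x)‖ / ‖S x‖) ^ (2 ^ n) ≤ ‖S ((D ^ (2 ^ n)) x)‖ := by
      intro n
      induction n with
      | zero => simp [mul_div_cancel₀ _ h0.ne']
      | succ n ih =>
        have h := hstep (2 ^ n)
        rw [← pow_succ'] at h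
        have h4 : (‖S x‖ * (‖S (D x)‖ / ‖S x‖) ^ (2 ^ n)) ^ 2 ≤ ‖S ((D ^ (2 ^ n)) x)‖ ^ 2 := by
          gcongr
        have h5 := h4.trans h
        rw [mul_pow, ← pow_mul, ← pow_succ, sq, mul_assoc] at h5
        exact le_of_mul_le_mul_left h5 h0
    set r := ‖S (D x)‖ / ‖S x‖ with hr
    have hrD : ‖D‖ < r := by rwa [hr, lt_div_iff₀ h0]
    have hr0 : 0 < r := (norm_nonneg D).trans_lt hrD
    have hub : ∀ n : ℕ, ‖S x‖ * r ^ (2 ^ n) ≤ ‖S‖ * ‖x‖ * ‖D‖ ^ (2 ^ n) := by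
      intro n
      refine (hgrow n).trans ((S.le_opNorm _).trans ?_)
      rw [mul_assoc]
      gcongr
      refine ((D ^ (2 ^ n)).le_opNorm x).trans ?_
      rw [mul_comm]
      gcongr
      exact norm_pow_le' D (by positivity)
    have hlim : Filter.Tendsto (fun n : ℕ => ‖S‖ * ‖x‖ * (‖D‖ / r) ^ (2 ^ n)) Filter.atTop
        (nhds (‖S‖ * ‖x‖ * 0)) :=
      ((tendsto_pow_atTop_nhds_zero_of_lt_one (by positivity)
        ((div_lt_one hr0).mpr hrD)).comp
          (tendsto_pow_atTop_atTop_of_one_lt (one_lt_two))).const_mul _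
    rw [mul_zero] at hlim
    have hle : ‖S x‖ ≤ 0 := by
      refine ge_of_tendsto' hlim (fun n => ?_)
      rw [div_pow, ← mul_div_assoc, le_div_iff₀ (by positivity)]
      exact hub n
    exact absurd h0 (not_lt.mpr hle)

/-- For injective `T` and `C` in the commutant of `T T ^ *`, the map `T⁻¹ C T` is an everywhere
defined bounded operator on `V`. -/
theorem exists_theta (T : V →L[ℂ] K) (hT : Function.Injective T) (C : K →L[ℂ] K)
    (hC : Commute C (gramOperator T)) : ∃ S : V →L[ℂ] V, T ∘L S = C ∘L T := by
  set D : K →L[ℂ] K := C * kreinAdjoint C with hDdef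
  have hcomm : ∀ x, C (gramOperator T x) = gramOperator T (C x) := fun x =>
    congrArg (fun f : K →L[ℂ] K => f x) hC.eq
  have hmove : ∀ x y : K, ⟪hilbertKreinAdjoint T (kreinAdjoint C x),
      hilbertKreinAdjoint T y⟫_ℂ = ⟪hilbertKreinAdjoint T x, hilbertKreinAdjoint T (C y)⟫_ℂ := by
    intro x y
    rw [← kreinForm_gram, ← kreinForm_gram, ← hcomm, kreinForm_apply_left C]
  have hmove' : ∀ x y : K, ⟪hilbertKreinAdjoint T (C x),
      hilbertKreinAdjoint T y⟫_ℂ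
        = ⟪hilbertKreinAdjoint T x, hilbertKreinAdjoint T (kreinAdjoint C y)⟫_ℂ := by
    intro x y
    rw [← inner_conj_symm, ← hmove, inner_conj_symm]
  have hDsymm : ∀ x y, ⟪hilbertKreinAdjoint T (D x), hilbertKreinAdjoint T y⟫_ℂ
      = ⟪hilbertKreinAdjoint T x, hilbertKreinAdjoint T (D y)⟫_ℂ := by
    intro x y
    simp only [hDdef, mul_apply_eq_comp]
    rw [hmove', hmove]
  have hbound : ∀ x, ‖hilbertKreinAdjoint T (kreinAdjoint C x)‖
      ≤ Real.sqrt ‖D‖ * ‖hilbertKreinAdjoint T x‖ := by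
    intro x
    have h1 : ((‖hilbertKreinAdjoint T (kreinAdjoint C x)‖ ^ 2 : ℝ) : ℂ)
        = ⟪hilbertKreinAdjoint T x, hilbertKreinAdjoint T (D x)⟫_ℂ := by
      rw [hDdef, mul_apply_eq_comp, ← hmove, inner_self_eq_norm_sq_to_K]
      simp
    have h2 := norm_inner_le_norm (𝕜 := ℂ) (hilbertKreinAdjoint T x)
      (hilbertKreinAdjoint T (D x))
    rw [← h1, Complex.norm_real, Real.norm_of_nonneg (by positivity)] at h2
    have h3 := norm_hilbertKreinAdjoint_le T D hDsymm x
    refine le_of_sq_le_sq ?_ (by positivity)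
    rw [mul_pow, Real.sq_sqrt (norm_nonneg D)]
    nlinarith [norm_nonneg (hilbertKreinAdjoint T x)]
  set R : V →L[ℂ] V := LinearMap.extendOfNorm
    ((hilbertKreinAdjoint T ∘L kreinAdjoint C).toLinearMap)
    (hilbertKreinAdjoint T).toLinearMap with hR
  have hRx : ∀ x, R (hilbertKreinAdjoint T x) = hilbertKreinAdjoint T (kreinAdjoint C x) := by
    intro x
    exact LinearMap.extendOfNorm_eq (denseRange_hilbertKreinAdjoint T hT) ⟨_, hbound⟩ x
  refine ⟨ContinuousLinearMap.adjoint R, ?_⟩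
  ext v
  apply kreinForm_ext
  intro z
  simp only [ContinuousLinearMap.comp_apply]
  rw [kreinForm_hilbert_left, ContinuousLinearMap.adjoint_inner_right, hRx,
    ← kreinForm_hilbert_left, kreinForm_apply_left]

/-- `Θ(C) = T⁻¹ C T`, the bounded operator on `V` with `T Θ(C) = C T`, for an injective bounded
`T : V → K` and `C` in the commutant of `T T ^ *`. -/
noncomputable def Theta (T : V →L[ℂ] K) (hT : Function.Injective T) (C : K →L[ℂ] K)
    (hC : Commute C (gramOperator T)) : V →L[ℂ] V :=
  (exists_theta T hT C hC).choose

theorem comp_Theta (T : V →L[ℂ] K) (hT : Function.Injective T) (C : K →L[ℂ] K)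
    (hC : Commute C (gramOperator T)) : T ∘L Theta T hT C hC = C ∘L T :=
  (exists_theta T hT C hC).choose_spec

theorem IsKreinNormal.commute_of_gram_eq {N : K →L[ℂ] K} (hN : IsKreinNormal N) {p q : ℝ[X]}
    {T : V →L[ℂ] K}
    (hT : gramOperator T = aeval (kreinRe N) p + aeval (kreinIm N) q) :
    Commute N (gramOperator T) := by
  have hA : Commute N (kreinRe N) := ((Commute.refl N).add_right hN).smul_right _
  have hB : Commute N (kreinIm N) := ((Commute.refl N).sub_right hN).smul_right _
  have key : ∀ (A : K →L[ℂ] K), Commute N A → ∀ r : ℝ[X], Commute N (aeval A r) := by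
    intro A hA r
    induction r using Polynomial.induction_on' with
    | add r s hr hs => rw [map_add]; exact hr.add_right hs
    | monomial n a =>
      rw [aeval_monomial]
      have hc : Commute N (algebraMap ℝ (K →L[ℂ] K) a) := (Algebra.commutes a N).symm
      exact hc.mul_right (hA.pow_right n)
  rw [hT]
  exact (key _ hA p).add_right (key _ hB q)

end Krein

/-- The set `Z_p^ℝ` of real zeros of `p`. -/
def realZeros (p : ℝ[X]) : Set ℝ := {x | p.eval x = 0}

/-- The set `Z_p^ℝ + i Z_q^ℝ`. -/
def realZeroGrid (p q : ℝ[X]) : Set ℂ :=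
  {z | ∃ x ∈ realZeros p, ∃ y ∈ realZeros q, z = (x : ℂ) + Complex.I * (y : ℂ)}

/-- The set `Z^i` of the pairs `(α, β)` of complex numbers with `p(α) = 0 = q(β)` that do not
belong to `ℝ × ℝ`. -/
def nonrealZeroPairs (p q : ℝ[X]) : Set (ℂ × ℂ) :=
  {w | aeval w.1 p = 0 ∧ aeval w.2 q = 0} \
    (Set.range ((↑) : ℝ → ℂ) ×ˢ Set.range ((↑) : ℝ → ℂ))

/-! ### Maximal ideals, inverse-closed centralizers and bicommutants in complex algebras -/

section Ring

/-! The inclusion `⊇` only needs that `Θ` carries inverses to inverses (`spectrum_Theta_subset`).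
For `⊆`, let `l ∈ σ(N)` lie outside `σ(Θ(N))`. Since `0 ≤ p(A) ≤ T T^*` in the Krein order, `p(A) =
T P T^*` with `P` bounded, and `R = T (Θ(N) - l)⁻¹ P T^*` solves `(N - l) R = p(A)`; likewise for
`q(B)`. Both quotients lie in the bicommutant `E` of `N` and `N^*`
(`exists_mul_eq_of_not_mem_spectrum_Theta`), which is commutative by normality and inverse-closed.
So `N - l` lies in a maximal ideal of `E`, which then contains `p(A)` and `q(B)`, hence `A - α` and
`B - β` for some roots `α`, `β`. This forces `l = α + iβ`, and `N^* - (α - iβ)` is in the ideal too,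
so it is not invertible; taking adjoints, `ᾱ + iβ̄ ∈ σ(N)`. -/

theorem exists_isRoot_sub_mem {R : Type*} [CommRing R] [Algebra ℂ R] {M : Ideal R}
    (hM : M.IsPrime) {p : ℂ[X]} (hp : p ≠ 0) {a : R} (h : aeval a p ∈ M) :
    ∃ α, p.IsRoot α ∧ a - algebraMap ℂ R α ∈ M := by
  rw [(IsAlgClosed.splits p).eq_prod_roots, map_mul, aeval_C, map_multiset_prod,
    Multiset.map_map] at h
  have hu : IsUnit (algebraMap ℂ R p.leadingCoeff) :=
    (IsUnit.mk0 _ (leadingCoeff_ne_zero.mpr hp)).map _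
  -- The polynomial splits over `ℂ`, and a prime ideal containing the product contains a linear
  -- factor.
  rw [Ideal.unit_mul_mem_iff_mem _ hu, hM.multiset_prod_mem_iff_exists_mem] at h
  obtain ⟨x, hx, hxM⟩ := h
  obtain ⟨α, hα, rfl⟩ := Multiset.mem_map.mp hx
  exact ⟨α, isRoot_of_mem_roots hα, by simpa using hxM⟩

theorem exists_isRoot_pair_of_not_isUnit {R : Type*} [CommRing R] [Algebra ℂ R] {a b : R}
    {l : ℂ} (hl : ¬ IsUnit (a + Complex.I • b - algebraMap ℂ R l)) {p q : ℂ[X]}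
    (hp : p ≠ 0) (hq : q ≠ 0) (hpa : a + Complex.I • b - algebraMap ℂ R l ∣ aeval a p)
    (hqb : a + Complex.I • b - algebraMap ℂ R l ∣ aeval b q) :
    ∃ α β, p.IsRoot α ∧ q.IsRoot β ∧ l = α + Complex.I * β ∧
      ¬ IsUnit (a - Complex.I • b - algebraMap ℂ R (α - Complex.I * β)) := by
  obtain ⟨M, hM, hlM⟩ := exists_max_ideal_of_mem_nonunits hl
  obtain ⟨α, hα, haM⟩ := exists_isRoot_sub_mem hM.isPrime hp (M.mem_of_dvd hpa hlM)
  obtain ⟨β, hβ, hbM⟩ := exists_isRoot_sub_mem hM.isPrime hq (M.mem_of_dvd hqb hlM)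
  have hIb := M.mul_mem_left (algebraMap ℂ R Complex.I) hbM
  refine ⟨α, β, hα, hβ, ?_, fun hu => hM.ne_top (M.eq_top_of_isUnit_mem ?_ hu)⟩
  -- `(a - α) + i(b - β) - (a + ib - l)` is a scalar in a proper ideal, hence zero.
  · have h : algebraMap ℂ R (l - (α + Complex.I * β)) ∈ M := by
      convert M.sub_mem (M.add_mem haM hIb) hlM using 1
      simp only [map_sub, map_add, map_mul, Algebra.smul_def]
      ring
    by_contra hne
    exact hM.ne_top (M.eq_top_of_isUnit_mem h ((IsUnit.mk0 _ (sub_ne_zero.mpr hne)).map _))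
  · convert M.sub_mem haM hIb using 1
    simp only [map_sub, map_mul, Algebra.smul_def]
    ring

/-- Form applicable to the bicommutant, whose instance is only `Ring`: commutativity enters as a
hypothesis and extends that same ring structure. -/
theorem exists_isRoot_pair_of_not_isUnit_of_comm {R : Type*} [r : Ring R] [Algebra ℂ R]
    (hcomm : ∀ x y : R, x * y = y * x) {a b : R}
    {l : ℂ} (hl : ¬ IsUnit (a + Complex.I • b - algebraMap ℂ R l)) {p q : ℂ[X]}
    (hp : p ≠ 0) (hq : q ≠ 0) (hpa : a + Complex.I • b - algebraMap ℂ R l ∣ aeval a p)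
    (hqb : a + Complex.I • b - algebraMap ℂ R l ∣ aeval b q) :
    ∃ α β, p.IsRoot α ∧ q.IsRoot β ∧ l = α + Complex.I * β ∧
      ¬ IsUnit (a - Complex.I • b - algebraMap ℂ R (α - Complex.I * β)) := by
  let _ : CommRing R := { r with mul_comm := hcomm }
  exact exists_isRoot_pair_of_not_isUnit hl hp hq hpa hqb

/-- The inverse of an element commuting with `s` commutes with `s`, so invertibility may be tested
in the ambient algebra. -/
theorem isUnit_subalgebra_centralizer {R : Type*} [Ring R] [Algebra ℂ R] {s : Set R}
    {x : Subalgebra.centralizer ℂ s} (hx : IsUnit (x : R)) : IsUnit x := by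
  obtain ⟨u, hu⟩ := hx
  have hmem : (↑u⁻¹ : R) ∈ Subalgebra.centralizer ℂ s := by
    rw [Subalgebra.mem_centralizer_iff]
    intro g hg
    have h : Commute g ↑u := by
      rw [hu]
      exact (Subalgebra.mem_centralizer_iff ℂ).mp x.2 g hg
    exact h.units_inv_right
  refine isUnit_iff_exists.mpr ⟨⟨_, hmem⟩, Subtype.ext ?_, Subtype.ext ?_⟩
  · simp [← hu]
  · simp [← hu]

/-- The bicommutant of a pair of elements. -/
abbrev bicommutant {R : Type*} [Ring R] [Algebra ℂ R] (n m : R) : Subalgebra ℂ R :=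
  Subalgebra.centralizer ℂ (Set.centralizer {n, m})

/-- Commuting generators lie in their own centralizer, and centralizers reverse inclusion, so the
bicommutant lies in the commutant. -/
theorem bicommutant_mul_comm {R : Type*} [Ring R] [Algebra ℂ R] {n m : R} (h : Commute n m)
    (x y : bicommutant n m) : x * y = y * x := by
  have hs : ({n, m} : Set R) ⊆ Set.centralizer {n, m} := by
    intro z hz w hw
    rcases hz with rfl | rfl <;> rcases hw with rfl | rfl
    · rfl
    · exact h.symm
    · exact h
    · rfl
  exact Subtype.ext (y.2 x (Set.centralizer_subset hs x.2))

theorem left_mem_bicommutant {R : Type*} [Ring R] [Algebra ℂ R] (n m : R) :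
    n ∈ bicommutant n m :=
  Set.subset_centralizer_centralizer (by simp)

theorem right_mem_bicommutant {R : Type*} [Ring R] [Algebra ℂ R] (n m : R) :
    m ∈ bicommutant n m :=
  Set.subset_centralizer_centralizer (by simp)

theorem commute_of_mem_bicommutant {R : Type*} [Ring R] [Algebra ℂ R] {n m x c : R}
    (hx : x ∈ bicommutant n m) (hn : Commute c n) (hm : Commute c m) : Commute c x := by
  refine hx c ?_
  rintro z (rfl | rfl)
  · exact hn.symm
  · exact hm.symm

end Ring

/-! ### Krein adjoints and the decomposition `N = A + iB` -/

section Krein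

variable {K : Type*} [NormedAddCommGroup K] [InnerProductSpace ℂ K] [CompleteSpace K]
  [KreinSpace K]
variable {V : Type*} [NormedAddCommGroup V] [InnerProductSpace ℂ V] [CompleteSpace V]

theorem kreinRe_add_smul_kreinIm (N : K →L[ℂ] K) : kreinRe N + Complex.I • kreinIm N = N := by
  have h : Complex.I * (1 / (2 * Complex.I)) = 1 / 2 := by field_simp
  rw [kreinRe, kreinIm, smul_smul, h]
  module

theorem kreinRe_sub_smul_kreinIm (N : K →L[ℂ] K) :
    kreinRe N - Complex.I • kreinIm N = kreinAdjoint N := by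
  have h : Complex.I * (1 / (2 * Complex.I)) = 1 / 2 := by field_simp
  rw [kreinRe, kreinIm, smul_smul, h]
  module

theorem kreinRe_mem_bicommutant (N : K →L[ℂ] K) :
    kreinRe N ∈ bicommutant N (kreinAdjoint N) :=
  Subalgebra.smul_mem _ (add_mem (left_mem_bicommutant _ _) (right_mem_bicommutant _ _)) _

theorem kreinIm_mem_bicommutant (N : K →L[ℂ] K) :
    kreinIm N ∈ bicommutant N (kreinAdjoint N) :=
  Subalgebra.smul_mem _ (sub_mem (left_mem_bicommutant _ _) (right_mem_bicommutant _ _)) _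

theorem kreinAdjoint_mul (M N : K →L[ℂ] K) :
    kreinAdjoint (M * N) = kreinAdjoint N * kreinAdjoint M := by
  ext x
  simp [kreinAdjoint, KreinSpace.J_J, ← ContinuousLinearMap.star_eq_adjoint]

theorem kreinAdjoint_one : kreinAdjoint (1 : K →L[ℂ] K) = 1 := by
  rw [kreinAdjoint, ← ContinuousLinearMap.star_eq_adjoint, star_one, mul_one,
    KreinSpace.J_mul_J]

theorem kreinAdjoint_sub_algebraMap (N : K →L[ℂ] K) (l : ℂ) :
    kreinAdjoint (N - algebraMap ℂ _ l) =
      kreinAdjoint N - algebraMap ℂ _ (starRingEnd ℂ l) := by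
  have h := KreinSpace.J_mul_J (K := K)
  simp only [kreinAdjoint, ← ContinuousLinearMap.star_eq_adjoint, star_sub, mul_sub, sub_mul,
    Algebra.algebraMap_eq_smul_one, star_smul, star_one, mul_smul_comm, mul_one, smul_mul_assoc,
    h]
  rfl

theorem isUnit_kreinAdjoint {N : K →L[ℂ] K} (hN : IsUnit N) : IsUnit (kreinAdjoint N) := by
  obtain ⟨M, h1, h2⟩ := isUnit_iff_exists.mp hN
  refine isUnit_iff_exists.mpr ⟨kreinAdjoint M, ?_, ?_⟩
  · rw [← kreinAdjoint_mul, h2, kreinAdjoint_one]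
  · rw [← kreinAdjoint_mul, h1, kreinAdjoint_one]

/-! ### Factorizations of Krein-positive operators -/

/-- A square root of the Gram operator of a positive operator on a Krein space. -/
theorem exists_sqrt_of_kreinForm_nonneg {G : K →L[ℂ] K}
    (hG : ∀ x, 0 ≤ kreinForm (G x) x) :
    ∃ W : K →L[ℂ] K, IsSelfAdjoint W ∧ ∀ x y, kreinForm (G x) y = ⟪W y, W x⟫_ℂ := by
  -- Krein positivity of `G` is Hilbert space positivity of `J G`; take `W = (J G)^{1/2}`.
  have hpos : 0 ≤ KreinSpace.J * G := by
    rw [ContinuousLinearMap.nonneg_iff_isPositive, ContinuousLinearMap.isPositive_iff_complex]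
    intro x
    have h : 0 ≤ ⟪(KreinSpace.J * G : K →L[ℂ] K) x, x⟫_ℂ := by
      rw [mul_apply_eq_comp, ← inner_conj_symm]
      exact star_nonneg_iff.mpr (hG x)
    obtain ⟨hre, him⟩ := Complex.nonneg_iff.mp h
    exact ⟨Complex.ext rfl him, hre⟩
  have hsa : IsSelfAdjoint (CFC.sqrt (KreinSpace.J * G)) :=
    (CFC.sqrt_nonneg _).isSelfAdjoint
  refine ⟨CFC.sqrt (KreinSpace.J * G), hsa, fun x y => ?_⟩
  rw [← ContinuousLinearMap.adjoint_inner_right, ← ContinuousLinearMap.star_eq_adjoint,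
    hsa.star_eq, ← mul_apply_eq_comp, CFC.sqrt_mul_sqrt_self _ hpos, mul_apply_eq_comp,
    kreinForm]

/-- With `W = (J G)^{1/2}`, let `T` be `J W` restricted to `(ker W)ᗮ`. Restricting makes `T`
injective; since `J ^ 2 = 1`, `T^*` is `W` with values in that subspace, so `T T^* = J W ^ 2 = G`.
-/
theorem exists_injective_gramOperator_eq {K : Type u} [NormedAddCommGroup K]
    [InnerProductSpace ℂ K] [CompleteSpace K] [KreinSpace K] {G : K →L[ℂ] K}
    (hG : ∀ x, 0 ≤ kreinForm (G x) x) :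
    ∃ (V : Type u) (_ : NormedAddCommGroup V) (_ : InnerProductSpace ℂ V)
        (_ : CompleteSpace V) (T : V →L[ℂ] K),
      Function.Injective T ∧ gramOperator T = G := by
  obtain ⟨W, hW, hGW⟩ := exists_sqrt_of_kreinForm_nonneg hG
  have hWs : ∀ x y, ⟪W x, y⟫_ℂ = ⟪x, W y⟫_ℂ := fun x y => by
    rw [← ContinuousLinearMap.adjoint_inner_right, ← ContinuousLinearMap.star_eq_adjoint,
      hW.star_eq]
  let U : Submodule ℂ K := (LinearMap.ker W.toLinearMap)ᗮ
  have hWU : ∀ x, W x ∈ U := fun x => (Submodule.mem_orthogonal _ _).mpr fun u hu => by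
    have hu0 : W u = 0 := hu
    rw [← hWs, hu0, inner_zero_left]
  let T : U →L[ℂ] K := (KreinSpace.J * W) ∘L U.subtypeL
  have hT : ∀ x, hilbertKreinAdjoint T x = ⟨W x, hWU x⟩ := by
    intro x
    refine ext_inner_right ℂ fun v => ?_
    rw [← kreinForm_hilbert_left]
    simp only [kreinForm, T, ContinuousLinearMap.comp_apply, mul_apply_eq_comp,
      KreinSpace.J_J, Submodule.subtypeL_apply, Submodule.coe_inner]
    rw [hWs]
  refine ⟨U, inferInstance, inferInstance, inferInstance, T, ?_, ?_⟩
  · rw [injective_iff_map_eq_zero]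
    intro v hv
    have h1 : W v = 0 := by
      rw [← KreinSpace.J_J (W v)]
      change KreinSpace.J (T v) = 0
      rw [hv, map_zero]
    have h2 : ⟪(v : K), v⟫_ℂ = 0 := (Submodule.mem_orthogonal _ _).mp v.2 _ h1
    exact Subtype.ext (inner_self_eq_zero.mp h2)
  · ext x
    refine kreinForm_ext fun y => ?_
    rw [kreinForm_gram, hT, hT, hGW]
    rfl

theorem kreinForm_add_left (x y z : K) : kreinForm (x + y) z = kreinForm x z + kreinForm y z := by
  simp [kreinForm]

/-- A positive operator dominated by `T T ^ *` factors as `T P T ^ *`. -/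
theorem exists_comp_hilbertKreinAdjoint_eq {T : V →L[ℂ] K} (hT : Function.Injective T)
    {F G : K →L[ℂ] K} (hF : ∀ x, 0 ≤ kreinForm (F x) x) (hG : ∀ x, 0 ≤ kreinForm (G x) x)
    (h : gramOperator T = F + G) :
    ∃ P : V →L[ℂ] V, ∀ x, T (P (hilbertKreinAdjoint T x)) = F x := by
  obtain ⟨W, -, hW⟩ := exists_sqrt_of_kreinForm_nonneg hF
  -- Douglas' argument: by this bound `T^* x ↦ W x` extends from the dense range of `T^*` to a
  -- contraction `R` on `V`, and `P = R^* R` works. The factor `1` is the constant required by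
  -- `LinearMap.extendOfNorm_eq`.
  have hle : ∀ x, ‖W x‖ ≤ 1 * ‖hilbertKreinAdjoint T x‖ := by
    intro x
    have h1 : kreinForm (F x) x ≤ kreinForm (gramOperator T x) x := by
      rw [h, add_apply, kreinForm_add_left]
      exact le_add_of_nonneg_right (hG x)
    rw [hW, kreinForm_gram, inner_self_eq_norm_sq_to_K, inner_self_eq_norm_sq_to_K] at h1
    have h2 : ‖W x‖ ^ 2 ≤ ‖hilbertKreinAdjoint T x‖ ^ 2 := by exact_mod_cast h1
    rw [one_mul]
    exact le_of_sq_le_sq h2 (norm_nonneg _)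
  let R : V →L[ℂ] K :=
    LinearMap.extendOfNorm W.toLinearMap (hilbertKreinAdjoint T).toLinearMap
  have hR : ∀ x, R (hilbertKreinAdjoint T x) = W x := fun x =>
    LinearMap.extendOfNorm_eq (denseRange_hilbertKreinAdjoint T hT) ⟨1, hle⟩ x
  refine ⟨ContinuousLinearMap.adjoint R ∘L R, fun x => kreinForm_ext fun y => ?_⟩
  rw [kreinForm_hilbert_left, ContinuousLinearMap.comp_apply,
    ContinuousLinearMap.adjoint_inner_right, hR, hR, hW]

/-! ### Transfer of the commutant of `T T^*` through `T` -/

/-- Cancel the injective `T` in `T X T^* = C T T^* = T T^* C`. -/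
theorem hilbertKreinAdjoint_intertwine {T : V →L[ℂ] K} (hT : Function.Injective T)
    {C : K →L[ℂ] K} (hC : Commute C (gramOperator T)) {X : V →L[ℂ] V}
    (hX : ∀ v, T (X v) = C (T v)) (x : K) :
    X (hilbertKreinAdjoint T x) = hilbertKreinAdjoint T (C x) :=
  hT ((hX _).trans (DFunLike.congr_fun hC.eq x))

theorem Theta_apply (T : V →L[ℂ] K) (hT : Function.Injective T) (C : K →L[ℂ] K)
    (hC : Commute C (gramOperator T)) (v : V) : T (Theta T hT C hC v) = C (T v) :=
  DFunLike.congr_fun (comp_Theta T hT C hC) v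

/-- The inverse of `l - C` also commutes with `T T^*`, so `Θ` applies to it and yields the inverse
of `l - Θ(C)`. -/
theorem spectrum_Theta_subset (T : V →L[ℂ] K) (hT : Function.Injective T) (C : K →L[ℂ] K)
    (hC : Commute C (gramOperator T)) : spectrum ℂ (Theta T hT C hC) ⊆ spectrum ℂ C := by
  intro l hl
  rw [spectrum.mem_iff] at hl ⊢
  refine fun hu => hl ?_
  obtain ⟨u, hu⟩ := hu
  have hcu : Commute (↑u : K →L[ℂ] K) (gramOperator T) := by
    rw [hu]
    exact Commute.sub_left (Algebra.commutes l _) hC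
  have hl' : ∀ v, T ((algebraMap ℂ (V →L[ℂ] V) l - Theta T hT C hC) v) =
      (u : K →L[ℂ] K) (T v) := by
    intro v
    simp [hu, Theta_apply, Algebra.algebraMap_eq_smul_one]
  have hY := Theta_apply T hT _ hcu.units_inv_left
  refine isUnit_iff_exists.mpr ⟨Theta T hT _ hcu.units_inv_left, ?_, ?_⟩
  · ext v
    apply hT
    rw [mul_apply_eq_comp, hl', hY, ← mul_apply_eq_comp, u.mul_inv]
    rfl
  · ext v
    apply hT
    rw [mul_apply_eq_comp, hY, hl', ← mul_apply_eq_comp, u.inv_mul]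
    rfl

/-- If `l` is not in the spectrum of `Θ(N)`, then `N - l` divides `T P T ^ *` in the bicommutant
of `N` and `N ^ *`. -/
theorem exists_mul_eq_of_not_mem_spectrum_Theta {T : V →L[ℂ] K} (hT : Function.Injective T)
    {N M : K →L[ℂ] K} (hN : Commute N (gramOperator T))
    (hG : gramOperator T ∈ bicommutant N M) {F : K →L[ℂ] K} (hF : F ∈ bicommutant N M)
    {P : V →L[ℂ] V} (hP : ∀ x, T (P (hilbertKreinAdjoint T x)) = F x) {l : ℂ}
    (hl : l ∉ spectrum ℂ (Theta T hT N hN)) :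
    ∃ R ∈ bicommutant N M, (N - algebraMap ℂ _ l) * R = F := by
  rw [spectrum.notMem_iff, ← IsUnit.neg_iff, neg_sub] at hl
  obtain ⟨u, hu⟩ := hl
  have huT : ∀ v, T ((u : V →L[ℂ] V) v) = (N - algebraMap ℂ _ l) (T v) := by
    intro v
    simp [hu, Theta_apply, Algebra.algebraMap_eq_smul_one]
  refine ⟨T ∘L (↑u⁻¹ : V →L[ℂ] V) ∘L P ∘L hilbertKreinAdjoint T, ?_, ?_⟩
  · rw [Subalgebra.mem_centralizer_iff]
    -- `C` commutes with `T T^*` and `F`, so `X = Θ(C)` exists. It commutes with `u`, and with `P`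
    -- on the dense range of `T^*`, hence everywhere; `C` then passes through the four factors one
    -- by one.
    intro C hC
    have hCN : Commute C N := (hC N (by simp)).symm
    have hCM : Commute C M := (hC M (by simp)).symm
    have hCG := commute_of_mem_bicommutant hG hCN hCM
    have hCF := commute_of_mem_bicommutant hF hCN hCM
    have hX := Theta_apply T hT C hCG
    have hXT := hilbertKreinAdjoint_intertwine hT hCG hX
    set X := Theta T hT C hCG
    have hXu : Commute X ↑u := by
      have hcomm : Commute C (N - algebraMap ℂ _ l) :=
        hCN.sub_right (Algebra.commutes l C).symm
      ext v
      apply hT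
      rw [mul_apply_eq_comp, mul_apply_eq_comp, hX, huT, huT, hX]
      exact DFunLike.congr_fun hcomm.eq (T v)
    have hXP : ∀ v, X (P v) = P (X v) := by
      refine fun v => congrFun ((denseRange_hilbertKreinAdjoint T hT).equalizer
        (X ∘L P).continuous (P ∘L X).continuous (funext fun x => hT ?_)) v
      simp only [Function.comp_apply, ContinuousLinearMap.comp_apply]
      rw [hX, hP, hXT, hP]
      exact DFunLike.congr_fun hCF.eq x
    have hXu' : ∀ v, X ((↑u⁻¹ : V →L[ℂ] V) v) = (↑u⁻¹ : V →L[ℂ] V) (X v) :=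
      fun v => DFunLike.congr_fun hXu.units_inv_right.eq v
    ext x
    simp only [mul_apply_eq_comp, ContinuousLinearMap.comp_apply]
    rw [← hX, hXu', hXP, hXT]
  · ext x
    simp only [mul_apply_eq_comp, ContinuousLinearMap.comp_apply]
    rw [← huT, ← mul_apply_eq_comp, u.mul_inv, one_apply_eq_self, hP]

end Krein

/-! ### The spectrum of `N` -/

theorem mainTheorem3 {K : Type u} [NormedAddCommGroup K] [InnerProductSpace ℂ K]
    [CompleteSpace K] [KreinSpace K] (N : K →L[ℂ] K) (hN : IsKreinNormal N) (p q : ℝ[X])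
    (hp : IsDefinitizing p (kreinRe N)) (hq : IsDefinitizing q (kreinIm N)) :
    (∃ (V : Type u) (_ : NormedAddCommGroup V) (_ : InnerProductSpace ℂ V)
        (_ : CompleteSpace V) (T : V →L[ℂ] K),
      Function.Injective T ∧
        gramOperator T = aeval (kreinRe N) p + aeval (kreinIm N) q) ∧
    ∀ (V : Type v) [NormedAddCommGroup V] [InnerProductSpace ℂ V] [CompleteSpace V]
      (T : V →L[ℂ] K) (hT : Function.Injective T)
      (hTT : gramOperator T = aeval (kreinRe N) p + aeval (kreinIm N) q),
      spectrum ℂ N =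
        spectrum ℂ (Theta T hT N (hN.commute_of_gram_eq hTT)) ∪
        (realZeroGrid p q ∩ spectrum ℂ N) ∪
        {z | ∃ w ∈ nonrealZeroPairs p q, z = w.1 + Complex.I * w.2 ∧
          w.1 + Complex.I * w.2 ∈ spectrum ℂ N ∧
          starRingEnd ℂ w.1 + Complex.I * starRingEnd ℂ w.2 ∈ spectrum ℂ N} := by
  constructor
  · refine exists_injective_gramOperator_eq fun x => ?_
    rw [add_apply, kreinForm_add_left]
    exact add_nonneg (hp.2 x) (hq.2 x)
  intro V _ _ _ T hT hTT
  refine Set.Subset.antisymm (fun l hl => ?_) (Set.union_subset (Set.union_subset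
    (spectrum_Theta_subset T hT N _) Set.inter_subset_right) ?_)
  swap
  · rintro _ ⟨w, -, rfl, h, -⟩
    exact h
  by_cases hlT : l ∈ spectrum ℂ (Theta T hT N (hN.commute_of_gram_eq hTT))
  · exact Or.inl (Or.inl hlT)
  let E := bicommutant N (kreinAdjoint N)
  let a : E := ⟨kreinRe N, kreinRe_mem_bicommutant N⟩
  let b : E := ⟨kreinIm N, kreinIm_mem_bicommutant N⟩
  -- The polynomials are complexified so that they split in the ideal argument; their values are
  -- unchanged.
  have haev : ∀ (x : E) (r : ℝ[X]),
      ((aeval x (r.map (algebraMap ℝ ℂ)) : E) : K →L[ℂ] K) = aeval (x : K →L[ℂ] K) r := by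
    intro x r
    rw [← aeval_map_algebraMap ℂ (x : K →L[ℂ] K) r]
    exact (aeval_algHom_apply E.val x _).symm
  have hpE : aeval (kreinRe N) p ∈ E := haev a p ▸ Subtype.property _
  have hqE : aeval (kreinIm N) q ∈ E := haev b q ▸ Subtype.property _
  have hGE : gramOperator T ∈ E := hTT ▸ add_mem hpE hqE
  have hn : ((a + Complex.I • b - algebraMap ℂ E l : E) : K →L[ℂ] K) = N - algebraMap ℂ _ l :=
    congrArg (· - algebraMap ℂ (K →L[ℂ] K) l) (kreinRe_add_smul_kreinIm N)
  obtain ⟨P, hP⟩ := exists_comp_hilbertKreinAdjoint_eq hT hp.2 hq.2 hTT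
  obtain ⟨Q, hQ⟩ := exists_comp_hilbertKreinAdjoint_eq hT hq.2 hp.2 (hTT.trans (add_comm _ _))
  obtain ⟨R₁, hR₁E, hR₁⟩ := exists_mul_eq_of_not_mem_spectrum_Theta hT _ hGE hpE hP hlT
  obtain ⟨R₂, hR₂E, hR₂⟩ := exists_mul_eq_of_not_mem_spectrum_Theta hT _ hGE hqE hQ hlT
  have hnu : ¬ IsUnit (a + Complex.I • b - algebraMap ℂ E l) := by
    intro hu
    have h := hu.map E.val
    rw [Subalgebra.coe_val, hn, ← IsUnit.neg_iff, neg_sub] at h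
    exact hl h
  have hmap : ∀ r : ℝ[X], r ≠ 0 → r.map (algebraMap ℝ ℂ) ≠ 0 := fun r hr =>
    (Polynomial.map_ne_zero_iff (algebraMap ℝ ℂ).injective).mpr hr
  obtain ⟨α, β, hα, hβ, rfl, hu⟩ := exists_isRoot_pair_of_not_isUnit_of_comm
    (bicommutant_mul_comm hN) hnu (hmap p hp.1) (hmap q hq.1)
    ⟨⟨R₁, hR₁E⟩, Subtype.ext (by rw [haev, MulMemClass.coe_mul, hn, hR₁])⟩
    ⟨⟨R₂, hR₂E⟩, Subtype.ext (by rw [haev, MulMemClass.coe_mul, hn, hR₂])⟩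
  have hα' : aeval α p = 0 := by rwa [IsRoot, eval_map_algebraMap] at hα
  have hβ' : aeval β q = 0 := by rwa [IsRoot, eval_map_algebraMap] at hβ
  by_cases hreal : (α, β) ∈ Set.range ((↑) : ℝ → ℂ) ×ˢ Set.range ((↑) : ℝ → ℂ)
  · obtain ⟨⟨x, hx⟩, ⟨y, hy⟩⟩ := hreal
    simp only at hx hy
    subst hx hy
    refine Or.inl (Or.inr ⟨⟨x, ?_, y, ?_, rfl⟩, hl⟩)
    · simpa [realZeros, ← Complex.coe_algebraMap, aeval_algebraMap_apply] using hα'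
    · simpa [realZeros, ← Complex.coe_algebraMap, aeval_algebraMap_apply] using hβ'
  · refine Or.inr ⟨(α, β), ⟨⟨hα', hβ'⟩, hreal⟩, rfl, hl, ?_⟩
    rw [spectrum.mem_iff, ← IsUnit.neg_iff, neg_sub]
    intro h
    refine hu (isUnit_subalgebra_centralizer ?_)
    -- The adjoint of `N - (ᾱ + iβ̄)` is `N^* - (α - iβ)`, which is not invertible in `E`, hence not
    -- in the full operator algebra.
    have h1 := isUnit_kreinAdjoint h
    rw [kreinAdjoint_sub_algebraMap] at h1
    have h2 : ((a - Complex.I • b - algebraMap ℂ E (α - Complex.I * β) : E) : K →L[ℂ] K)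
        = kreinAdjoint N - algebraMap ℂ _ (α - Complex.I * β) :=
      congrArg (· - algebraMap ℂ (K →L[ℂ] K) _) (kreinRe_sub_smul_kreinIm N)
    rw [h2]
    convert h1 using 3
    simp [sub_eq_add_neg]
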